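/- Let $F$ be a field and let $K\supseteq F$ be an algebraically closed field (for instance $F=\mathbb{R}$ or $F=\mathbb{C}$, and $K=\mathbb{C}$). Let $A,C\in F^{p\times m}$. The Kronecker canonical form (KCF) of the pencil $A-\lambda C$ is the direct sum of blocks, unique up to the order of the blocks, that equals $P(A-\lambda C)Q$ for some invertible $P\in K^{p\times p}$, $Q\in K^{m\times m}$. Its blocks are of the following types: Jordan blocks $J_k(\alpha)-\lambda I_k$ ($\alpha\in K$, $k\ge 1$) for finite eigenvalues, Jordan blocks $I_k-\lambda J_k(0)$ ($k\geq 1$) for the eigenvalue $\infty$, right singular blocks $$L_\varepsilon=\begin{bmatrix}\lambda&1\\&\ddots&\ddots\\&&\lambda&1\end{bmatrix}$$ of size $\varepsilon\times(\varepsilon+1)$ ($\varepsilon\ge 0$), and left singular blocks $L_\eta^\top$ of size $(\eta+1)\times\eta$ ($\eta\geq 0$). For an integer $s\ge 1$ and matrices $A,C\in F^{p\times m}$ define the $p(s+1)\times ms$ matrix $$M_s(A,C):=\begin{bmatrix}A\\ C&A\\ &C&\ddots\\ &&\ddots&A\\ &&&C\end{bmatrix},$$ with $s+1$ block rows and $s$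 block columns. Then: 1. for every integer $\varepsilon\ge 1$, the KCF of $A-\lambda C$ consists only of blocks $L_\varepsilon$ if and only if $M_\varepsilon(A,C)$ is square (that is, $p(\varepsilon+1)=m\varepsilon$) and invertible; 2. for every integer $\eta\ge 1$, the KCF of $A-\lambda C$ consists only of blocks $L_\eta^\top$ if and only if $M_\eta(A^\top,C^\top)$ is square (that is, $m(\eta+1)=p\eta$) and invertible. -/

import Mathlib

/-- The blocks of the Kronecker canonical form of a pencil over `K`: Jordan blocks of positive size
(finite eigenvalue `α`, or eigenvalue `∞`), right singular blocks `L_ε` and left singular blocks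
`L_ηᵀ`, with `ε, η ≥ 0`. -/
inductive KroneckerBlock (K : Type*) where
  | jordan (α : K) (k : ℕ+)
  | jordanInfty (k : ℕ+)
  | rightSingular (ε : ℕ)
  | leftSingular (η : ℕ)

namespace KroneckerBlock

variable {K : Type*}

/-- The number of rows of a block. -/
def rows : KroneckerBlock K → ℕ
  | jordan _ k => k
  | jordanInfty k => k
  | rightSingular ε => ε
  | leftSingular η => η + 1

/-- The number of columns of a block. -/
def cols : KroneckerBlock K → ℕ
  | jordan _ k => k
  | jordanInfty k => k
  | rightSingular ε => ε + 1
  | leftSingular η => η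

variable [Field K]

/-- The matrix with ones at the positions `(i, i + 1)` and zeros elsewhere. -/
def upperShift (r c : ℕ) : Matrix (Fin r) (Fin c) K :=
  Matrix.of fun i j => if (j : ℕ) = i + 1 then 1 else 0

/-- The rectangular matrix with ones at the positions `(i, i)` and zeros elsewhere. -/
def mainDiag (r c : ℕ) : Matrix (Fin r) (Fin c) K :=
  Matrix.of fun i j => if (j : ℕ) = i then 1 else 0

/-- The coefficient `A` of a block written as `A - λ C`. The blocks are `J_k(α) - λ I`,
`I - λ J_k(0)`, `L_ε` (with rows `(… λ 1 …)`) and `L_ηᵀ`. -/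
def coeffA : (b : KroneckerBlock K) → Matrix (Fin b.rows) (Fin b.cols) K
  | jordan α k => α • mainDiag k k + upperShift k k
  | jordanInfty k => mainDiag k k
  | rightSingular ε => upperShift ε (ε + 1)
  | leftSingular η => (upperShift η (η + 1)).transpose

/-- The coefficient `C` of a block written as `A - λ C`. -/
def coeffC : (b : KroneckerBlock K) → Matrix (Fin b.rows) (Fin b.cols) K
  | jordan _ k => mainDiag k k
  | jordanInfty k => upperShift k k
  | rightSingular ε => -mainDiag ε (ε + 1)
  | leftSingular η => -(mainDiag η (η + 1)).transpose

end KroneckerBlock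

/-- The direct sum of the blocks `b 0, …, b (k - 1)` is a Kronecker canonical form of `A - λ C`:
`P (A - λ C) Q` is the direct sum of the blocks, for some invertible constant matrices `P`, `Q`.
The bijections `er`, `ec` only number the rows and columns of the direct sum. -/
def IsKroneckerCanonicalForm {K : Type*} [Field K] {p m : ℕ} (A C : Matrix (Fin p) (Fin m) K)
    {k : ℕ} (b : Fin k → KroneckerBlock K) : Prop :=
  ∃ (er : Fin p ≃ (i : Fin k) × Fin (b i).rows) (ec : Fin m ≃ (i : Fin k) × Fin (b i).cols)
    (P : GL (Fin p) K) (Q : GL (Fin m) K),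
    P.val * A * Q.val =
        (Matrix.blockDiagonal' fun i => (b i).coeffA).submatrix er ec ∧
      P.val * C * Q.val =
        (Matrix.blockDiagonal' fun i => (b i).coeffC).submatrix er ec

/-- The Kronecker canonical form of `A - λ C` consists only of blocks equal to `b₀`. -/
def KCFConsistsOnlyOf {K : Type*} [Field K] {p m : ℕ} (A C : Matrix (Fin p) (Fin m) K)
    (b₀ : KroneckerBlock K) : Prop :=
  ∃ (k : ℕ) (b : Fin k → KroneckerBlock K),
    IsKroneckerCanonicalForm A C b ∧ ∀ i, b i = b₀

/-- The block bidiagonal matrix `M_s(A, C)` with `s + 1` block rows and `s` block columns: the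
`j`-th block column has `A` in block row `j`, `C` in block row `j + 1`, and zeros elsewhere. -/
def blockBidiagonal {F : Type*} [Field F] {p m : ℕ} (s : ℕ) (A C : Matrix (Fin p) (Fin m) F) :
    Matrix (Fin (s + 1) × Fin p) (Fin s × Fin m) F :=
  Matrix.of fun x y =>
    if x.1 = y.1.castSucc then A x.2 y.2 else if x.1 = y.1.succ then C x.2 y.2 else 0

/-- A matrix is square (as many rows as columns) and invertible (it has a two-sided inverse). -/
def IsSquareInvertible {F : Type*} [Field F] {r c : Type*} [Fintype r] [Fintype c]
    [DecidableEq r] [DecidableEq c] (M : Matrix r c F) : Prop :=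
  Fintype.card r = Fintype.card c ∧ ∃ N : Matrix c r F, M * N = 1 ∧ N * M = 1

/-! Let `a`, `c` be the linear maps of `A`, `C`. Encoding `y` as the polynomial `∑ y_i t^i`, the
matrix `M_s` is multiplication by `a + t c` on polynomials of degree `< s`. If the pair is a sum of
copies of `L_s`, its relations let zeros spread along diagonals of coordinates, so `M_s` is
injective (`IsRightSingularSum.chainMap_injective`), and it is square by counting. Conversely, let
`M_s` be bijective and let `N` be the kernel at the next level. An element of `N` satisfies `a n_0 =
0`, `a n_{j+1} = -c n_j`, `c n_s = 0`, which are the relations of one `L_s`. The coefficients of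
such elements span `V` (`exists_sum_ker_chainMap`), and `dim V = (s+1) dim N`, `dim W = s dim N`.
Hence a basis of `N` yields the decomposition (`exists_isRightSingularSum`). Invertibility is
insensitive to extending `F` to `K`, and transposition gives the left blocks. -/

/-! ### Multiplication by `a + t c` on polynomials of bounded degree -/

section ChainMap

variable {K V W : Type*} [Field K] [AddCommGroup V] [Module K V] [AddCommGroup W] [Module K W]

/-- The linear map `(y₀, …, y_{s-1}) ↦ (a y₀, c y₀ + a y₁, …, c y_{s-1})`. -/
def chainMap (a c : V →ₗ[K] W) (s : ℕ) : (Fin s → V) →ₗ[K] (Fin (s + 1) → W) where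
  toFun y := (Fin.snoc (fun i => a (y i)) 0 : Fin (s + 1) → W) +
    (Fin.cons 0 (fun i => c (y i)) : Fin (s + 1) → W)
  map_add' x y := by
    ext i
    have h1 : (Fin.snoc (fun i => a ((x + y) i)) 0 : Fin (s + 1) → W) =
        (Fin.snoc (fun i => a (x i)) 0 : Fin (s + 1) → W) +
          (Fin.snoc (fun i => a (y i)) 0 : Fin (s + 1) → W) := by
      ext i; refine Fin.lastCases ?_ (fun j => ?_) i <;> simp
    have h2 : (Fin.cons 0 (fun i => c ((x + y) i)) : Fin (s + 1) → W) =
        (Fin.cons 0 (fun i => c (x i)) : Fin (s + 1) → W) +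
          (Fin.cons 0 (fun i => c (y i)) : Fin (s + 1) → W) := by
      ext i; refine Fin.cases ?_ (fun j => ?_) i <;> simp
    rw [h1, h2]
    simp only [Pi.add_apply]
    abel
  map_smul' r x := by
    have h1 : (Fin.snoc (fun i => a ((r • x) i)) 0 : Fin (s + 1) → W) =
        r • (Fin.snoc (fun i => a (x i)) 0 : Fin (s + 1) → W) := by
      ext i; refine Fin.lastCases ?_ (fun j => ?_) i <;> simp
    have h2 : (Fin.cons 0 (fun i => c ((r • x) i)) : Fin (s + 1) → W) =
        r • (Fin.cons 0 (fun i => c (x i)) : Fin (s + 1) → W) := by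
      ext i; refine Fin.cases ?_ (fun j => ?_) i <;> simp
    rw [h1, h2, ← smul_add]
    rfl

variable (a c : V →ₗ[K] W) {s : ℕ}

theorem chainMap_apply (y : Fin s → V) (i : Fin (s + 1)) :
    chainMap a c s y i = (Fin.snoc (fun i => a (y i)) 0 : Fin (s + 1) → W) i +
      (Fin.cons 0 (fun i => c (y i)) : Fin (s + 1) → W) i := rfl

theorem chainMap_zero (y : Fin (s + 1) → V) : chainMap a c (s + 1) y 0 = a (y 0) := by
  rw [chainMap_apply, Fin.cons_zero, add_zero, ← Fin.castSucc_zero, Fin.snoc_castSucc]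

theorem chainMap_last (y : Fin (s + 1) → V) :
    chainMap a c (s + 1) y (Fin.last (s + 1)) = c (y (Fin.last s)) := by
  rw [chainMap_apply, Fin.snoc_last, zero_add, ← Fin.succ_last, Fin.cons_succ]

theorem chainMap_succ_castSucc (y : Fin (s + 1) → V) (i : Fin s) :
    chainMap a c (s + 1) y i.succ.castSucc = a (y i.succ) + c (y i.castSucc) := by
  rw [chainMap_apply, Fin.snoc_castSucc, ← Fin.succ_castSucc, Fin.cons_succ]

/-- In polynomial terms, a zero top coefficient changes nothing but the degree bound;
`chainMap_cons` is the companion for multiplication by `t`. -/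
theorem chainMap_snoc (y : Fin s → V) :
    chainMap a c (s + 1) (Fin.snoc y 0 : Fin (s + 1) → V) =
      (Fin.snoc (chainMap a c s y) 0 : Fin (s + 2) → W) := by
  ext i
  refine Fin.lastCases ?_ (fun i => ?_) i
  · rw [chainMap_last]; simp
  rw [Fin.snoc_castSucc]
  refine Fin.cases ?_ (fun j => ?_) i
  · rw [chainMap_apply, chainMap_apply, Fin.snoc_castSucc, Fin.castSucc_zero, Fin.cons_zero,
      Fin.cons_zero]
    congr 1
    generalize (0 : Fin (s + 1)) = i
    refine Fin.lastCases ?_ (fun j => ?_) i <;> simp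
  · rw [chainMap_succ_castSucc, chainMap_apply, Fin.cons_succ, Fin.snoc_castSucc]
    congr 1
    generalize j.succ = i
    refine Fin.lastCases ?_ (fun j => ?_) i <;> simp

theorem chainMap_cons (y : Fin s → V) :
    chainMap a c (s + 1) (Fin.cons 0 y : Fin (s + 1) → V) =
      (Fin.cons 0 (chainMap a c s y) : Fin (s + 2) → W) := by
  ext i
  refine Fin.cases ?_ (fun i => ?_) i
  · rw [chainMap_zero]; simp
  rw [Fin.cons_succ]
  refine Fin.lastCases ?_ (fun j => ?_) i
  · rw [Fin.succ_last, chainMap_last, chainMap_apply, Fin.snoc_last, zero_add]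
    generalize Fin.last s = i
    refine Fin.cases ?_ (fun j => ?_) i <;> simp
  · rw [Fin.succ_castSucc, chainMap_succ_castSucc, chainMap_apply, Fin.cons_succ,
      Fin.snoc_castSucc]
    congr 1
    generalize j.castSucc = i
    refine Fin.cases ?_ (fun j => ?_) i <;> simp

theorem Fin.snoc_single {n : ℕ} (i : Fin n) (w : W) :
    (Fin.snoc (Pi.single i w : Fin n → W) 0 : Fin (n + 1) → W) = Pi.single i.castSucc w := by
  ext j
  refine Fin.lastCases ?_ (fun j => ?_) j
  · simp [(Fin.castSucc_lt_last i).ne']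
  · simp [Pi.single_apply]

theorem Fin.cons_single {n : ℕ} (i : Fin n) (w : W) :
    (Fin.cons 0 (Pi.single i w : Fin n → W) : Fin (n + 1) → W) = Pi.single i.succ w := by
  ext j
  refine Fin.cases ?_ (fun j => ?_) j
  · simp [(Fin.succ_ne_zero i).symm]
  · simp [Pi.single_apply]

theorem chainMap_single (i : Fin s) (w : V) :
    chainMap a c s (Pi.single i w) = Pi.single i.castSucc (a w) + Pi.single i.succ (c w) := by
  rw [← Fin.snoc_single, ← Fin.cons_single]
  ext j
  rw [chainMap_apply, Pi.add_apply]
  congr 3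
  · ext k; simp [Pi.single_apply, apply_ite a]
  · ext k; simp [Pi.single_apply, apply_ite c]

variable {a c}

theorem chainMap_succ_surjective (h : Function.Surjective (chainMap a c s)) :
    Function.Surjective (chainMap a c (s + 1)) := by
  intro g
  obtain ⟨y, hy⟩ := h (Pi.single 0 (g 0))
  obtain ⟨z, hz⟩ := h (Fin.tail g)
  -- The unshifted part produces the constant term of `g`, the shifted part all the others.
  refine ⟨(Fin.snoc y 0 : Fin (s + 1) → V) + (Fin.cons 0 z : Fin (s + 1) → V), ?_⟩
  rw [map_add, chainMap_snoc, chainMap_cons, hy, hz, Fin.snoc_single]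
  ext i
  refine Fin.cases ?_ (fun i => ?_) i
  · simp
  · simp [Fin.tail, Fin.succ_ne_zero]

theorem surjective_of_chainMap_surjective
    (h : Function.Surjective (chainMap a c (s + 1))) : Function.Surjective a := by
  intro w
  obtain ⟨y, hy⟩ := h (Pi.single 0 w)
  exact ⟨y 0, by rw [← chainMap_zero a c, hy, Pi.single_eq_same]⟩

/-- Every vector is a sum of diagonal coefficients of elements of the kernel of the next
chain map. -/
theorem exists_sum_ker_chainMap (h : Function.Bijective (chainMap a c s)) (w : V) :
    ∃ n : Fin (s + 1) → LinearMap.ker (chainMap a c (s + 1)), ∑ j, (n j).1 j = w := by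
  choose y hy using fun j => h.2 (Pi.single j (a w))
  choose z hz using fun j => h.2 (Pi.single j (c w))
  -- The image of `w t^j` is `(a w) t^j + (c w) t^(j+1)`; the two corrections cancel these terms.
  -- For `j = s` or `j = 0` only one of them meets the diagonal.
  refine ⟨fun j => ⟨Pi.single j w - (Fin.snoc (y j) 0 : Fin (s + 1) → V) -
    (Fin.cons 0 (z j) : Fin (s + 1) → V), ?_⟩, ?_⟩
  · rw [LinearMap.mem_ker, map_sub, map_sub, chainMap_single, chainMap_snoc, chainMap_cons, hy,
      hz, Fin.snoc_single, Fin.cons_single]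
    abel
  -- By injectivity the corrections pair up to `w`, so the diagonal sum is `(s + 1) w - s w = w`.
  · have key (j : Fin s) : y j.castSucc j + z j.succ j = w := by
      have : y j.castSucc + z j.succ = Pi.single j w :=
        h.1 (by rw [map_add, hy, hz, chainMap_single])
      simpa using congrFun this j
    simp only [Pi.sub_apply, Pi.single_eq_same, Finset.sum_sub_distrib]
    rw [Fin.sum_univ_castSucc (fun j => (Fin.snoc (y j) 0 : Fin (s + 1) → V) j),
      Fin.sum_univ_succ (fun j => (Fin.cons 0 (z j) : Fin (s + 1) → V) j)]
    simp only [Fin.snoc_castSucc, Fin.snoc_last, Fin.cons_zero, Fin.cons_succ, add_zero, zero_add]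
    rw [sub_sub, ← Finset.sum_add_distrib, Fin.sum_univ_castSucc (fun _ => w)]
    simp [key]

/-! ### Direct sums of copies of `L_s` -/

/-- The pair `(a, c)` is, in suitable coordinates, a direct sum of `k` copies of the pair of
coefficients of `L_s`. -/
def IsRightSingularSum (a c : V →ₗ[K] W) (s k : ℕ) : Prop :=
  ∃ (E : V ≃ₗ[K] (Fin (s + 1) → Fin k → K)) (G : W ≃ₗ[K] (Fin s → Fin k → K)),
    ∀ v, (∀ j, G (a v) j = E v j.succ) ∧ ∀ j, G (c v) j = - E v j.castSucc

theorem IsRightSingularSum.chainMap_injective {k : ℕ} (h : IsRightSingularSum a c s k) :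
    Function.Injective (chainMap a c s) := by
  obtain ⟨E, G, h⟩ := h
  rw [← LinearMap.ker_eq_bot, LinearMap.ker_eq_bot']
  intro y hy
  obtain _ | s := s
  · exact Subsingleton.elim _ _
  have h0 (j) : E (y 0) (Fin.succ j) = 0 := by
    rw [← (h _).1, ← chainMap_zero a c, hy]; simp
  have h1 (j) : E (y (Fin.last s)) (Fin.castSucc j) = 0 := by
    rw [← neg_eq_zero, ← (h _).2, ← chainMap_last a c, hy]; simp
  have h2 (i : Fin s) (j) : E (y i.succ) (Fin.succ j) = E (y i.castSucc) (Fin.castSucc j) := by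
    rw [← sub_eq_zero, sub_eq_add_neg, ← (h _).1, ← (h _).2, ← Pi.add_apply, ← map_add,
      ← chainMap_succ_castSucc, hy]
    simp
  -- By `h2` coordinates are constant along diagonals. Those with `i < j` trace back to `y 0`, where
  -- `h0` kills them; those with `j ≤ i` run forward to the last vector, where `h1` does.
  have hlt (i : Fin (s + 1)) : ∀ j : Fin (s + 2), i.castSucc < j → E (y i) j = 0 := by
    induction i using Fin.induction with
    | zero =>
      intro j hj
      obtain ⟨j, rfl⟩ := Fin.exists_succ_eq.2 (Fin.ne_zero_of_lt hj)
      exact h0 j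
    | succ i ih =>
      intro j hj
      obtain ⟨j, rfl⟩ := Fin.exists_succ_eq.2 (Fin.ne_zero_of_lt hj)
      rw [h2]
      apply ih
      simp only [Fin.lt_def, Fin.val_castSucc, Fin.val_succ] at hj ⊢
      omega
  have hle (i : Fin (s + 1)) : ∀ j : Fin (s + 2), j ≤ i.castSucc → E (y i) j = 0 := by
    induction i using Fin.reverseInduction with
    | last =>
      intro j hj
      obtain ⟨j, rfl⟩ := Fin.exists_castSucc_eq.2
        (hj.trans_lt (Fin.castSucc_lt_last (Fin.last s))).ne
      exact h1 j
    | cast i ih =>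
      intro j hj
      obtain ⟨j, rfl⟩ := Fin.exists_castSucc_eq.2
        (hj.trans_lt (Fin.castSucc_lt_last i.castSucc)).ne
      rw [← h2]
      apply ih
      simp only [Fin.le_def, Fin.val_castSucc, Fin.val_succ] at hj ⊢
      omega
  ext i : 1
  apply E.injective
  rw [Pi.zero_apply, map_zero]
  ext j : 1
  exact (le_or_gt j i.castSucc).elim (hle i j) (hlt i j)

theorem exists_isRightSingularSum [FiniteDimensional K V] [FiniteDimensional K W]
    (hs : 0 < s) (h : Function.Bijective (chainMap a c s)) :
    ∃ k, IsRightSingularSum a c s k := by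
  set N := LinearMap.ker (chainMap a c (s + 1)) with hN
  let Φ : (Fin (s + 1) → N) →ₗ[K] V :=
    ∑ j, (LinearMap.proj j).comp (N.subtype.comp (LinearMap.proj j))
  have hΦ (n) : Φ n = ∑ j, (n j).1 j := by simp [Φ]
  let Ψ : (Fin s → N) →ₗ[K] W :=
    ∑ j : Fin s, a.comp ((LinearMap.proj j.succ).comp (N.subtype.comp (LinearMap.proj j)))
  have hΨ (n) : Ψ n = ∑ j, a ((n j).1 j.succ) := by simp [Ψ]
  have hker (n : N) := LinearMap.mem_ker.1 n.2
  -- The kernel relations make `Φ` and `Ψ` intertwine `(a, c)` with the shift and the negated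
  -- truncation, the coefficients of `L_s` tensored with `N`.
  have haΦ (n) : a (Φ n) = Ψ (fun j => n j.succ) := by
    rw [hΦ, hΨ, map_sum, Fin.sum_univ_succ, ← chainMap_zero a c, hker]
    simp
  have hcΦ (n) : c (Φ n) = - Ψ (fun j => n j.castSucc) := by
    rw [hΦ, hΨ, map_sum, Fin.sum_univ_castSucc, ← chainMap_last a c, hker, Pi.zero_apply,
      add_zero, ← Finset.sum_neg_distrib]
    refine Finset.sum_congr rfl fun j _ => ?_
    rw [eq_neg_iff_add_eq_zero, add_comm, ← chainMap_succ_castSucc, hker]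
    rfl
  have hΦs : Function.Surjective Φ := fun w => by
    obtain ⟨n, hn⟩ := exists_sum_ker_chainMap h w
    exact ⟨n, by rw [hΦ, hn]⟩
  have hΨs : Function.Surjective Ψ := fun w => by
    obtain ⟨s, rfl⟩ := Nat.exists_eq_add_of_lt hs
    obtain ⟨v, rfl⟩ := surjective_of_chainMap_surjective (by simpa using h.2) w
    obtain ⟨n, rfl⟩ := hΦs v
    exact ⟨_, (haΦ n).symm⟩
  have hdim := (LinearEquiv.ofBijective _ h).finrank_eq
  have hrank := LinearMap.finrank_range_add_finrank_ker (chainMap a c (s + 1))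
  rw [LinearMap.range_eq_top.2 (chainMap_succ_surjective h.2), finrank_top, ← hN] at hrank
  simp only [Module.finrank_pi_fintype, Finset.sum_const, Finset.card_univ, Fintype.card_fin,
    smul_eq_mul] at hdim hrank
  have hV : (s + 1) * Module.finrank K N = Module.finrank K V := by
    zify at hdim hrank ⊢
    -- This eliminates `dim W` and leaves `dim V` with coefficient `(s+1)^2 - s(s+2) = 1`.
    linear_combination (s + 1 : ℤ) * hrank + (s + 2 : ℤ) * hdim
  have hW : s * Module.finrank K N = Module.finrank K W := by
    apply Nat.eq_of_mul_eq_mul_left (Nat.succ_pos s)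
    rw [Nat.succ_eq_add_one, ← hdim, ← hV]
    ring
  have hΦb := (LinearMap.injective_iff_surjective_of_finrank_eq_finrank (f := Φ)
    (by simp [Module.finrank_pi_fintype, hV])).2 hΦs
  have hΨb := (LinearMap.injective_iff_surjective_of_finrank_eq_finrank (f := Ψ)
    (by simp [Module.finrank_pi_fintype, hW])).2 hΨs
  let β := (Module.finBasis K N).equivFun
  let Φe := LinearEquiv.ofBijective Φ ⟨hΦb, hΦs⟩
  let Ψe := LinearEquiv.ofBijective Ψ ⟨hΨb, hΨs⟩
  refine ⟨Module.finrank K N, Φe.symm.trans (LinearEquiv.piCongrRight fun _ => β),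
    Ψe.symm.trans (LinearEquiv.piCongrRight fun _ => β), fun v => ?_⟩
  obtain ⟨n, rfl⟩ := Φe.surjective v
  have e1 : a (Φe n) = Ψe (fun j => n j.succ) := haΦ n
  have e2 : c (Φe n) = Ψe (- fun j => n j.castSucc) := by
    rw [map_neg]; exact hcΦ n
  constructor <;> intro j
  · rw [e1]; simp
  · rw [e2]; simp

end ChainMap

/-! ### From linear maps to matrices and canonical forms -/

section Matrices

variable {K : Type*} [Field K]

theorem isSquareInvertible_iff {r c : Type*} [Fintype r] [Fintype c]
    [DecidableEq r] [DecidableEq c] (M : Matrix r c K) :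
    IsSquareInvertible M ↔ Fintype.card r = Fintype.card c ∧ Function.Injective M.mulVec := by
  refine and_congr_right fun hcard => ⟨?_, fun h => ?_⟩
  · rintro ⟨N, -, hN⟩ x y hxy
    simpa [hN] using congrArg N.mulVec hxy
  · let e := LinearMap.linearEquivOfInjective M.mulVecLin h (by simp [hcard])
    have hM : M = LinearMap.toMatrix' e.toLinearMap := by
      have : e.toLinearMap = M.mulVecLin := by ext; rfl
      rw [this, ← Matrix.toLin'_apply', LinearMap.toMatrix'_toLin']
    refine ⟨LinearMap.toMatrix' e.symm.toLinearMap, ?_, ?_⟩ <;>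
    · rw [hM, ← LinearMap.toMatrix'_comp]
      simp

/-- Injectivity restricts from vectors over `K` to vectors over `F`, while an inverse over `F` maps
to one over `K`. -/
theorem isSquareInvertible_map_iff {F : Type*} [Field F] [Algebra F K] {r c : Type*} [Fintype r]
    [Fintype c] [DecidableEq r] [DecidableEq c] (M : Matrix r c F) :
    IsSquareInvertible (M.map (algebraMap F K)) ↔ IsSquareInvertible M := by
  constructor
  · simp only [isSquareInvertible_iff]
    refine And.imp_right fun h x y hxy => ?_
    have := @h (algebraMap F K ∘ x) (algebraMap F K ∘ y) (by
      ext i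
      rw [← RingHom.map_mulVec, ← RingHom.map_mulVec]
      exact congrArg _ (congrFun hxy i))
    exact (algebraMap F K).injective.comp_left this
  · rintro ⟨hcard, N, h1, h2⟩
    refine ⟨hcard, N.map (algebraMap F K), ?_, ?_⟩
    · rw [← Matrix.map_mul, h1]; simp
    · rw [← Matrix.map_mul, h2]; simp

theorem blockBidiagonal_map {F : Type*} [Field F] [Algebra F K] {p m : ℕ} (s : ℕ)
    (A C : Matrix (Fin p) (Fin m) F) :
    (blockBidiagonal s A C).map (algebraMap F K) =
      blockBidiagonal s (A.map (algebraMap F K)) (C.map (algebraMap F K)) := by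
  ext x y
  simp only [blockBidiagonal, Matrix.map_apply, Matrix.of_apply]
  split_ifs <;> simp

theorem blockBidiagonal_mulVec {p m : ℕ} (s : ℕ) (A C : Matrix (Fin p) (Fin m) K)
    (y : Fin s × Fin m → K) (x : Fin (s + 1) × Fin p) :
    (blockBidiagonal s A C).mulVec y x =
      chainMap A.mulVecLin C.mulVecLin s (Function.curry y) x.1 x.2 := by
  obtain ⟨i, r⟩ := x
  have hsplit (i : Fin (s + 1)) (j : Fin s) (u v : K) :
      (if i = j.castSucc then u else if i = j.succ then v else 0) =
        (if i = j.castSucc then u else 0) + if i = j.succ then v else 0 := by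
    by_cases h : i = j.castSucc
    · have : i ≠ j.succ := h ▸ (Fin.castSucc_lt_succ).ne
      simp [h, h ▸ this]
    · simp [h]
  rw [chainMap_apply, Pi.add_apply]
  simp only [Matrix.mulVec, dotProduct, Fintype.sum_prod_type, blockBidiagonal, Matrix.of_apply,
    hsplit, add_mul, Finset.sum_add_distrib]
  congr 1
  · refine Fin.lastCases ?_ (fun i => ?_) i
    · simp [(Fin.castSucc_lt_last _).ne']
    · rw [Finset.sum_eq_single i (by simp +contextual [eq_comm]) (by simp)]
      simp [Matrix.mulVec, dotProduct]
  · refine Fin.cases ?_ (fun i => ?_) i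
    · simp [(Fin.succ_ne_zero _).symm]
    · rw [Finset.sum_eq_single i (by simp +contextual [eq_comm]) (by simp)]
      simp [Matrix.mulVec, dotProduct]

theorem blockBidiagonal_mulVec_injective_iff {p m : ℕ} (s : ℕ) (A C : Matrix (Fin p) (Fin m) K) :
    Function.Injective (blockBidiagonal s A C).mulVec ↔
      Function.Injective (chainMap A.mulVecLin C.mulVecLin s) := by
  constructor
  · intro h x y hxy
    have := @h (Function.uncurry x) (Function.uncurry y) (by
      ext i; simp only [blockBidiagonal_mulVec, Function.curry_uncurry, hxy])
    simpa using congrArg Function.curry this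
  · intro h x y hxy
    have := @h (Function.curry x) (Function.curry y) (by
      ext i r
      rw [← blockBidiagonal_mulVec s A C x (i, r), ← blockBidiagonal_mulVec s A C y (i, r), hxy])
    simpa using congrArg Function.uncurry this

/-- The invertible matrix of a linear automorphism of coordinate space. -/
def LinearEquiv.toGL' {n : Type*} [Fintype n] [DecidableEq n] (L : (n → K) ≃ₗ[K] (n → K)) :
    GL n K where
  val := LinearMap.toMatrix' L.toLinearMap
  inv := LinearMap.toMatrix' L.symm.toLinearMap
  val_inv := by rw [← LinearMap.toMatrix'_comp]; simp
  inv_val := by rw [← LinearMap.toMatrix'_comp]; simp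

theorem blockDiagonal_upperShift_mulVec {k s : ℕ} (g : (_ : Fin k) × Fin (s + 1) → K)
    (x : (_ : Fin k) × Fin s) :
    (Matrix.blockDiagonal' fun _ : Fin k => (KroneckerBlock.upperShift s (s + 1) :
      Matrix (Fin s) (Fin (s + 1)) K)).mulVec g x = g ⟨x.1, x.2.succ⟩ := by
  obtain ⟨i, j⟩ := x
  simp only [Matrix.mulVec, dotProduct, Fintype.sum_sigma]
  rw [Finset.sum_eq_single i (fun b _ hb => Finset.sum_eq_zero fun l _ => by
    rw [Matrix.blockDiagonal'_apply_ne _ _ _ hb.symm, zero_mul]) (by simp)]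
  simp only [Matrix.blockDiagonal'_apply_eq, KroneckerBlock.upperShift, Matrix.of_apply]
  rw [Finset.sum_eq_single j.succ (fun b _ hb => by
    rw [if_neg fun h => hb (Fin.ext (by simpa using h)), zero_mul]) (by simp)]
  simp

theorem blockDiagonal_neg_mainDiag_mulVec {k s : ℕ} (g : (_ : Fin k) × Fin (s + 1) → K)
    (x : (_ : Fin k) × Fin s) :
    (Matrix.blockDiagonal' fun _ : Fin k => (-KroneckerBlock.mainDiag s (s + 1) :
      Matrix (Fin s) (Fin (s + 1)) K)).mulVec g x = -g ⟨x.1, x.2.castSucc⟩ := by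
  obtain ⟨i, j⟩ := x
  simp only [Matrix.mulVec, dotProduct, Fintype.sum_sigma]
  rw [Finset.sum_eq_single i (fun b _ hb => Finset.sum_eq_zero fun l _ => by
    rw [Matrix.blockDiagonal'_apply_ne _ _ _ hb.symm, zero_mul]) (by simp)]
  simp only [Matrix.blockDiagonal'_apply_eq, KroneckerBlock.mainDiag, Matrix.of_apply,
    Matrix.neg_apply]
  rw [Finset.sum_eq_single j.castSucc (fun b _ hb => by
    rw [if_neg fun h => hb (Fin.ext (by simpa using h)), neg_zero, zero_mul]) (by simp)]
  simp

/-- Coordinates indexed by a numbered direct sum of `k` blocks of size `n`, regrouped. -/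
def sigmaCoordEquiv {q k n : ℕ} (e : Fin q ≃ (_ : Fin k) × Fin n) :
    (Fin q → K) ≃ₗ[K] (Fin n → Fin k → K) where
  toFun v j i := v (e.symm ⟨i, j⟩)
  invFun g x := g (e x).2 (e x).1
  map_add' _ _ := rfl
  map_smul' _ _ := rfl
  left_inv v := by ext x; simp
  right_inv g := by ext j i; simp

theorem mul_eq_submatrix_mul_iff {p m : ℕ} {r c : Type*} [Fintype c]
    (A : Matrix (Fin p) (Fin m) K) (P : Matrix (Fin p) (Fin p) K) (Q : Matrix (Fin m) (Fin m) K)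
    (er : Fin p ≃ r) (ec : Fin m ≃ c) (D : Matrix r c K) :
    P * A = D.submatrix er ec * Q ↔ ∀ v x, P.mulVec (A.mulVec v) (er.symm x) =
      D.mulVec (fun y => Q.mulVec v (ec.symm y)) x := by
  rw [← Matrix.mulVec_injective.eq_iff, funext_iff]
  refine forall_congr' fun v => ?_
  rw [funext_iff, ← er.symm.forall_congr_right]
  refine forall_congr' fun x => ?_
  rw [← Matrix.mulVec_mulVec, ← Matrix.mulVec_mulVec, Matrix.submatrix_mulVec_equiv]
  simp [Function.comp_def]

theorem kcfConsistsOnlyOf_rightSingular_iff {p m : ℕ} (A C : Matrix (Fin p) (Fin m) K) (s : ℕ) :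
    KCFConsistsOnlyOf A C (KroneckerBlock.rightSingular s) ↔
      ∃ k, IsRightSingularSum A.mulVecLin C.mulVecLin s k := by
  constructor
  · rintro ⟨k, b, ⟨er, ec, P, Q, hA, hC⟩, hb⟩
    obtain rfl : b = fun _ => KroneckerBlock.rightSingular s := funext hb
    have hQ : Q.val * (Q⁻¹).val = 1 := Q.mul_inv
    have hA' := congrArg (· * (Q⁻¹).val) hA
    have hC' := congrArg (· * (Q⁻¹).val) hC
    simp only [Matrix.mul_assoc, hQ, Matrix.mul_one] at hA' hC'
    have hA'' := (mul_eq_submatrix_mul_iff A P.val (Q⁻¹).val er ec _).1 hA'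
    have hC'' := (mul_eq_submatrix_mul_iff C P.val (Q⁻¹).val er ec _).1 hC'
    refine ⟨k, (Matrix.toLin'OfInv Q.mul_inv Q.inv_mul).trans (sigmaCoordEquiv ec),
      (Matrix.toLin'OfInv P.inv_mul P.mul_inv).trans (sigmaCoordEquiv er),
      fun v => ⟨fun j => ?_, fun j => ?_⟩⟩
    · ext i
      exact (hA'' v ⟨i, j⟩).trans (blockDiagonal_upperShift_mulVec _ ⟨i, j⟩)
    · ext i
      exact (hC'' v ⟨i, j⟩).trans (blockDiagonal_neg_mainDiag_mulVec _ ⟨i, j⟩)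
  · rintro ⟨k, E, G, h⟩
    have hm := E.finrank_eq
    have hp := G.finrank_eq
    simp only [Module.finrank_pi_fintype, Module.finrank_self, Finset.sum_const, Finset.card_univ,
      Fintype.card_fin, smul_eq_mul, mul_one] at hm hp
    -- Any numbering works: `E` and `G` are composed with its inverse to define `Q` and `P`.
    let er : Fin p ≃ (_ : Fin k) × Fin s := Fintype.equivOfCardEq (by simp [hp, mul_comm])
    let ec : Fin m ≃ (_ : Fin k) × Fin (s + 1) := Fintype.equivOfCardEq (by simp [hm, mul_comm])
    let Q := (E.trans (sigmaCoordEquiv ec).symm).toGL'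
    let P := (G.trans (sigmaCoordEquiv er).symm).toGL'
    have hQ : Q.val * (Q⁻¹).val = 1 := Q.mul_inv
    have hQv (v) (y) : Q.val.mulVec v (ec.symm y) = E v y.2 y.1 := by
      simp [Q, LinearEquiv.toGL', LinearMap.toMatrix'_mulVec, sigmaCoordEquiv]
    have hPv (v) (y) : P.val.mulVec v (er.symm y) = G v y.2 y.1 := by
      simp [P, LinearEquiv.toGL', LinearMap.toMatrix'_mulVec, sigmaCoordEquiv]
    -- `Q` carries the old coordinates to the new ones, so the canonical form uses its inverse.
    refine ⟨k, fun _ => KroneckerBlock.rightSingular s, ⟨er, ec, P, Q⁻¹, ?_, ?_⟩, fun _ => rfl⟩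
    · have := (mul_eq_submatrix_mul_iff A P.val Q.val er ec
        (Matrix.blockDiagonal' fun _ => KroneckerBlock.upperShift s (s + 1))).2 fun v x => by
          rw [blockDiagonal_upperShift_mulVec, hQv, hPv]
          exact congrFun ((h v).1 x.2) x.1
      rw [this, Matrix.mul_assoc, hQ, Matrix.mul_one]
      rfl
    · have := (mul_eq_submatrix_mul_iff C P.val Q.val er ec
        (Matrix.blockDiagonal' fun _ => -KroneckerBlock.mainDiag s (s + 1))).2 fun v x => by
          rw [blockDiagonal_neg_mainDiag_mulVec, hQv, hPv]
          exact congrFun ((h v).2 x.2) x.1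
      rw [this, Matrix.mul_assoc, hQ, Matrix.mul_one]
      rfl

theorem kcfConsistsOnlyOf_rightSingular_iff_isSquareInvertible {p m : ℕ}
    (A C : Matrix (Fin p) (Fin m) K) {s : ℕ} (hs : 0 < s) :
    KCFConsistsOnlyOf A C (KroneckerBlock.rightSingular s) ↔
      IsSquareInvertible (blockBidiagonal s A C) := by
  rw [kcfConsistsOnlyOf_rightSingular_iff, isSquareInvertible_iff,
    blockBidiagonal_mulVec_injective_iff]
  simp only [Fintype.card_prod, Fintype.card_fin]
  constructor
  · rintro ⟨k, h⟩
    refine ⟨?_, h.chainMap_injective⟩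
    obtain ⟨E, G, -⟩ := h
    have hm := E.finrank_eq
    have hp := G.finrank_eq
    simp only [Module.finrank_pi_fintype, Module.finrank_self, Finset.sum_const, Finset.card_univ,
      Fintype.card_fin, smul_eq_mul, mul_one] at hm hp
    rw [hm, hp]
    ring
  · rintro ⟨hcard, h⟩
    exact exists_isRightSingularSum hs ⟨h, (LinearMap.injective_iff_surjective_of_finrank_eq_finrank
      (by simp [Module.finrank_pi_fintype, hcard])).1 h⟩

/-! ### Left singular blocks by transposition -/

/-- The transpose of an invertible matrix, as an invertible matrix. -/
def Matrix.GeneralLinearGroup.transposeUnit {n : Type*} [Fintype n] [DecidableEq n] (P : GL n K) :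
    GL n K where
  val := P.val.transpose
  inv := (P⁻¹).val.transpose
  val_inv := by rw [← Matrix.transpose_mul, ← Units.val_mul]; simp
  inv_val := by rw [← Matrix.transpose_mul, ← Units.val_mul]; simp

theorem mul_mul_transpose_eq {p m : ℕ} {k : ℕ} {r c : Fin k → ℕ} {A : Matrix (Fin p) (Fin m) K}
    {P : Matrix (Fin p) (Fin p) K} {Q : Matrix (Fin m) (Fin m) K}
    {er : Fin p ≃ (i : Fin k) × Fin (r i)} {ec : Fin m ≃ (i : Fin k) × Fin (c i)}
    {D : (i : Fin k) → Matrix (Fin (r i)) (Fin (c i)) K}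
    (h : P * A * Q = (Matrix.blockDiagonal' D).submatrix er ec) :
    Q.transpose * A.transpose * P.transpose =
      (Matrix.blockDiagonal' fun i => (D i).transpose).submatrix ec er := by
  rw [← Matrix.blockDiagonal'_transpose, ← Matrix.transpose_submatrix, ← h,
    Matrix.transpose_mul, Matrix.transpose_mul, Matrix.mul_assoc]

theorem kcfConsistsOnlyOf_leftSingular_iff {p m : ℕ} (A C : Matrix (Fin p) (Fin m) K) (s : ℕ) :
    KCFConsistsOnlyOf A C (KroneckerBlock.leftSingular s) ↔
      KCFConsistsOnlyOf A.transpose C.transpose (KroneckerBlock.rightSingular s) := by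
  constructor
  · rintro ⟨k, b, ⟨er, ec, P, Q, hA, hC⟩, hb⟩
    obtain rfl : b = fun _ => KroneckerBlock.leftSingular s := funext hb
    refine ⟨k, fun _ => KroneckerBlock.rightSingular s,
      ⟨ec, er, Q.transposeUnit, P.transposeUnit, mul_mul_transpose_eq hA, ?_⟩, fun _ => rfl⟩
    exact mul_mul_transpose_eq hC
  · rintro ⟨k, b, ⟨er, ec, P, Q, hA, hC⟩, hb⟩
    obtain rfl : b = fun _ => KroneckerBlock.rightSingular s := funext hb
    refine ⟨k, fun _ => KroneckerBlock.leftSingular s,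
      ⟨ec, er, Q.transposeUnit, P.transposeUnit, mul_mul_transpose_eq hA, ?_⟩, fun _ => rfl⟩
    exact mul_mul_transpose_eq hC

end Matrices

/-! ### Conclusion over the base field -/

theorem mainTheorem6 {F K : Type*} [Field F] [Field K] [IsAlgClosed K] [Algebra F K]
    {p m : ℕ} (A C : Matrix (Fin p) (Fin m) F) :
    (∀ ε : ℕ, 0 < ε →
      (KCFConsistsOnlyOf (A.map (algebraMap F K)) (C.map (algebraMap F K))
          (KroneckerBlock.rightSingular ε) ↔
        IsSquareInvertible (blockBidiagonal ε A C))) ∧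
    (∀ η : ℕ, 0 < η →
      (KCFConsistsOnlyOf (A.map (algebraMap F K)) (C.map (algebraMap F K))
          (KroneckerBlock.leftSingular η) ↔
        IsSquareInvertible (blockBidiagonal η A.transpose C.transpose))) := by
  refine ⟨fun ε hε => ?_, fun η hη => ?_⟩
  · rw [kcfConsistsOnlyOf_rightSingular_iff_isSquareInvertible _ _ hε, ← blockBidiagonal_map,
      isSquareInvertible_map_iff]
  · rw [kcfConsistsOnlyOf_leftSingular_iff,
      kcfConsistsOnlyOf_rightSingular_iff_isSquareInvertible _ _ hη, ← Matrix.transpose_map,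
      ← Matrix.transpose_map, ← blockBidiagonal_map, isSquareInvertible_map_iff]
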